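/- Let $Y$ be a real random variable and $X$ a random vector in $\mathbb{R}^p$ with $E(Y^2)<\infty$, $E(\|X\|^2)<\infty$, $V(Y)>0$, $V(X)$ non-singular, and $E(Y|X)=\alpha_0+X'\beta_0$ for some $(\alpha_0,\beta_0)\in\mathbb{R}\times\mathbb{R}^p$. For an integrable random variable or vector $A$ write $A_0=A-E(A)$, and let $F_A$ denote the cdf of a real random variable $A$. For a cdf $F$ let $F^{-1}(t)=\inf\{x:F(x)\ge t\}$. For cdfs $F,G$ of mean-zero distributions and $\varepsilon\in(0,1/2)$ let $$R(\alpha,F,G)=\frac{\int_\alpha^1F^{-1}(t)\,dt}{\int_\alpha^1G^{-1}(t)\,dt},\qquad S_\varepsilon(F,G)=\min_{\alpha\in[\varepsilon,1-\varepsilon]}R(\alpha,F,G)$$ (with $R(\alpha,F,G)=+\infty$ if the denominator vanishes, which happens only if $G$ is degenerate), and, with $\mathbb{S}$ the Euclidean unit sphere of $\mathbb{R}^p$, $$\mathcal{B}_\varepsilon=\{\lambda q:\ q\in\mathbb{S},\ 0\le\lambda\le S_\varepsilon(F_{Y_0},F_{X_0'q})\}.$$ Let $(Y_1,\dots,Y_{n_Y})$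 and $(X_1,\dots,X_{n_X})$ be two independent samples of i.i.d. variables with the same distributions as $Y$ and $X$ respectively, with sample means $\overline{Y},\overline{X}$. Let $\widehat F_Y$ and $\widehat F_{X'q}$ be the empirical cdfs of $Y_1,\dots,Y_{n_Y}$ and $X_1'q,\dots,X_{n_X}'q$, let $\widehat F_{Y_0}(t)=\widehat F_Y(t+\overline{Y})$ and $\widehat F_{X_0'q}(t)=\widehat F_{X'q}(t+\overline{X}'q)$, and let $$\widehat{\mathcal{B}}_\varepsilon=\{\lambda q:\ q\in\mathbb{S},\ 0\le\lambda<\infty,\ \lambda\le S_\varepsilon(\widehat F_{Y_0},\widehat F_{X_0'q})\}.$$ Let $d_H(C,C')=\max\big(\sup_{c'\in C'}\inf_{c\in C}\|c-c'\|,\ \sup_{c\in C}\inf_{c'\in C'}\|c-c'\|\big)\in[0,\infty]$ be the Hausdorff distance. Then, for every $\varepsilon\in(0,1/2)$, as $n:=n_Xn_Y/(n_X+n_Y)\to\infty$, $$d_H(\widehat{\mathcal{B}}_\varepsilon,\mathcal{B}_\varepsilon)\ \stackrel{\mathbb{P}}{\longrightarrow}\ 0,$$ that is, $P\big(d_H(\widehat{\mathcal{B}}_\varepsilon,\mathcal{B}_\varepsilon)\ge\delta\big)\to0$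 for every $\delta>0$. -/

import Mathlib

open MeasureTheory ProbabilityTheory Filter Topology

noncomputable section

namespace TwoSample

/-- The generalized inverse `F⁻¹(t) = inf {x : F(x) ≥ t}` of a function `F : ℝ → ℝ`. -/
def quantile (F : ℝ → ℝ) (t : ℝ) : ℝ := sInf {x : ℝ | t ≤ F x}

/-- The upper quantile integral `∫_α^1 F⁻¹(t) dt`. -/
def upperInt (F : ℝ → ℝ) (α : ℝ) : ℝ := ∫ t in α..1, quantile F t

/-- The ratio of superquantiles `R(α, F, G) = ∫_α^1 F⁻¹ / ∫_α^1 G⁻¹`. For non-degenerate cdfs of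
mean zero both integrals are positive. The denominator vanishes when `G` is degenerate (which may
happen for an empirical cdf); the ratio is then `+∞`. -/
def superquantileRatio (α : ℝ) (F G : ℝ → ℝ) : EReal :=
  if upperInt G α = 0 then ⊤ else ((upperInt F α / upperInt G α : ℝ) : EReal)

/-- `S_ε(F, G) = min_{α ∈ [ε, 1 - ε]} R(α, F, G)`. -/
def radial (ε : ℝ) (F G : ℝ → ℝ) : EReal :=
  ⨅ α ∈ Set.Icc ε (1 - ε), superquantileRatio α F G

/-- The set `{λ q : q ∈ 𝕊, 0 ≤ λ ≤ S_ε(F, G_q)}`, where `𝕊` is the Euclidean unit sphere of `ℝ^p`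
and `G_q` is a cdf for each direction `q`. -/
def starSet {p : ℕ} (ε : ℝ) (F : ℝ → ℝ) (G : EuclideanSpace ℝ (Fin p) → ℝ → ℝ) :
    Set (EuclideanSpace ℝ (Fin p)) :=
  {b | ∃ q ∈ Metric.sphere (0 : EuclideanSpace ℝ (Fin p)) 1, ∃ l : ℝ,
    0 ≤ l ∧ (l : EReal) ≤ radial ε F (G q) ∧ b = l • q}

/-- The cdf of a real random variable `Z` under `P`. -/
def cdfOf {Ω : Type*} [MeasurableSpace Ω] (P : Measure Ω) (Z : Ω → ℝ) (t : ℝ) : ℝ :=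
  cdf (P.map Z) t

/-- The variance matrix `V(X)` of a random vector. -/
def varianceMatrix {Ω : Type*} [MeasurableSpace Ω] {p : ℕ} (P : Measure Ω)
    (X : Ω → EuclideanSpace ℝ (Fin p)) : Matrix (Fin p) (Fin p) ℝ :=
  Matrix.of fun i j => covariance (fun ω => X ω i) (fun ω => X ω j) P

/-- The regularized set `B_ε = {λ q : q ∈ 𝕊, 0 ≤ λ ≤ S_ε(F_{Y₀}, F_{X₀'q})}`, where
`Y₀ = Y - E(Y)` and `X₀ = X - E(X)`. -/
def regularizedSet {Ω : Type*} [MeasurableSpace Ω] {p : ℕ} (P : Measure Ω) (ε : ℝ)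
    (Y : Ω → ℝ) (X : Ω → EuclideanSpace ℝ (Fin p)) : Set (EuclideanSpace ℝ (Fin p)) :=
  starSet ε (cdfOf P fun ω => Y ω - ∫ ω', Y ω' ∂P)
    (fun q => cdfOf P fun ω => inner ℝ (X ω - ∫ ω', X ω' ∂P) q)

/-- The mean of the first `n` terms of a sequence. -/
def sampleMean {E : Type*} [AddCommGroup E] [Module ℝ E] (n : ℕ) (z : ℕ → E) : E :=
  (n : ℝ)⁻¹ • ∑ i ∈ Finset.range n, z i

/-- The empirical cdf of the first `n` terms of a real sequence. -/
def empiricalCdf (n : ℕ) (z : ℕ → ℝ) (t : ℝ) : ℝ :=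
  (((Finset.range n).filter fun i => z i ≤ t).card : ℝ) / n

/-- The plug-in estimator `{λ q : q ∈ 𝕊, 0 ≤ λ ≤ S_ε(F̂_{Y₀}, F̂_{X₀'q})}` computed from
`y 0, …, y (nY - 1)` and `x 0, …, x (nX - 1)`, where `F̂_{Y₀}(t) = F̂_Y(t + Ȳ)` and
`F̂_{X₀'q}(t) = F̂_{X'q}(t + X̄'q)`. -/
def pluginSet {p : ℕ} (ε : ℝ) (nY nX : ℕ) (y : ℕ → ℝ) (x : ℕ → EuclideanSpace ℝ (Fin p)) :
    Set (EuclideanSpace ℝ (Fin p)) :=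
  starSet ε (fun t => empiricalCdf nY y (t + sampleMean nY y))
    (fun q t => empiricalCdf nX (fun i => inner ℝ (x i) q) (t + inner ℝ (sampleMean nX x) q))

/-- The effective sample size `n = n_X n_Y / (n_X + n_Y)` for the pair `m = (n_Y, n_X)`. -/
def effectiveSize (m : ℕ × ℕ) : ℝ := ((m.2 : ℝ) * (m.1 : ℝ)) / ((m.2 : ℝ) + (m.1 : ℝ))

end TwoSample

end

/-! For an integrable law the Rockafellar–Uryasev formula gives `∫_α^1 F⁻¹ = min_c {(1 - α)c + E(W -
c)₊}`, with minimiser the `α`-quantile (`upperInt_cdf_le`, `upperInt_cdf_eq`). For `α ∈ [ε, 1 - ε]`,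
Markov's inequality bounds this quantile by `E|W|/ε`. Two upper quantile integrals therefore differ
by at most the largest gap between the stop-loss transforms `E(W - c)₊` over a compact range of `c`.

The functions `(q, c) ↦ (x'q - c)₊` on a compact `K = 𝕊 × [-M, M]` form one element of `C(K, ℝ)`
depending continuously on `x`. A single law of large numbers in that Banach space is thus uniform in
direction and level (`tendsto_measure_upperInt_centeredProj`). `Y` is the case of dimension one, and
an empirical law is the law of the data under the uniform measure on indices, so population lemmas
apply to samples.

The denominators are at least `ε E(X₀'q)₊`, which non-singularity of `V(X)` and compactness of the
sphere bound away from zero. Hence the ratios, and their infima over `α`, converge uniformly in `q`.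
Shrinking points along their ray bounds the Hausdorff distance by the uniform gap between radial
functions (`hausdorffEDist_starSet_le`). -/

namespace TwoSample

/-! ### Quantile functions and the Rockafellar–Uryasev formula. -/

section Quantile

/-- For `t ∈ (0, 1)` the defining set is nonempty and bounded below, and right-continuity puts its
infimum in it. Later facts about `quantile` all derive from this Galois connection. -/
theorem quantile_cdf_le_iff (μ : Measure ℝ) {t : ℝ} (ht0 : 0 < t) (ht1 : t < 1) (x : ℝ) :
    quantile (cdf μ) t ≤ x ↔ t ≤ cdf μ x := by
  have hne : {x : ℝ | t ≤ cdf μ x}.Nonempty :=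
    (((tendsto_cdf_atTop μ).eventually (eventually_ge_nhds ht1)).exists)
  have hbdd : BddBelow {x : ℝ | t ≤ cdf μ x} := by
    obtain ⟨b, hb⟩ := ((tendsto_cdf_atBot μ).eventually (eventually_lt_nhds ht0)).exists
    refine ⟨b, fun x hx => ?_⟩
    by_contra! h
    exact absurd (hx.trans (monotone_cdf μ h.le)) (not_le.2 hb)
  refine ⟨fun h => ?_, fun h => csInf_le hbdd h⟩
  refine ge_of_tendsto (((cdf μ).right_continuous x).tendsto.mono_left
    (nhdsWithin_mono x Set.Ioi_subset_Ici_self)) ?_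
  filter_upwards [self_mem_nhdsWithin] with y hy
  obtain ⟨z, hz, hzy⟩ := (csInf_lt_iff hbdd hne).1 (lt_of_le_of_lt h hy)
  exact le_trans (show t ≤ cdf μ z from hz) (monotone_cdf μ hzy.le)

theorem monotoneOn_quantile_cdf (μ : Measure ℝ) : MonotoneOn (quantile (cdf μ)) (Set.Ioo 0 1) := by
  intro s hs t ht hst
  rw [quantile_cdf_le_iff μ hs.1 hs.2]
  exact hst.trans ((quantile_cdf_le_iff μ ht.1 ht.2 _).1 le_rfl)

theorem aemeasurable_quantile_cdf (μ : Measure ℝ) :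
    AEMeasurable (quantile (cdf μ)) (volume.restrict (Set.Ioo 0 1)) :=
  aemeasurable_restrict_of_monotoneOn measurableSet_Ioo (monotoneOn_quantile_cdf μ)

instance isProbabilityMeasure_restrict_Ioo :
    IsProbabilityMeasure ((volume : Measure ℝ).restrict (Set.Ioo 0 1)) :=
  ⟨by simp⟩

variable (μ : Measure ℝ) [IsProbabilityMeasure μ]

/-- The quantile function pushes Lebesgue measure on `(0, 1)` forward to the law. -/
theorem map_quantile_cdf :
    (volume.restrict (Set.Ioo (0 : ℝ) 1)).map (quantile (cdf μ)) = μ := by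
  have hq := aemeasurable_quantile_cdf μ
  have := Measure.isProbabilityMeasure_map hq
  refine Measure.ext_of_Iic _ _ fun x => ?_
  rw [Measure.map_apply_of_aemeasurable hq measurableSet_Iic, Measure.restrict_apply₀']
  · rw [← ofReal_cdf]
    have h1 : quantile (cdf μ) ⁻¹' Set.Iic x ∩ Set.Ioo 0 1 = Set.Iic (cdf μ x) ∩ Set.Ioo 0 1 := by
      ext t
      simp only [Set.mem_inter_iff, Set.mem_preimage, Set.mem_Iic]
      exact and_congr_left fun ht => quantile_cdf_le_iff μ ht.1 ht.2 x
    rw [h1]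
    refine le_antisymm ?_ ?_
    · refine (measure_mono (t := Set.Ioc 0 (cdf μ x)) fun t ht => ⟨ht.2.1, ht.1⟩).trans ?_
      simp
    · refine le_trans (by simp) (measure_mono (s := Set.Ioo 0 (cdf μ x)) fun t ht => ?_)
      exact ⟨ht.2.le, ht.1, ht.2.trans_le (cdf_le_one μ x)⟩
  · exact measurableSet_Ioo.nullMeasurableSet

theorem integrableOn_comp_quantile_cdf {f : ℝ → ℝ} (hf : Integrable f μ) :
    IntegrableOn (fun t => f (quantile (cdf μ) t)) (Set.Ioo 0 1) := by
  have h := map_quantile_cdf μ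
  rw [← h] at hf
  have := hf.comp_aemeasurable (aemeasurable_quantile_cdf μ)
  exact this

theorem integral_comp_quantile_cdf {f : ℝ → ℝ} (hf : Integrable f μ) :
    ∫ t in Set.Ioo 0 1, f (quantile (cdf μ) t) = ∫ x, f x ∂μ := by
  have h := map_quantile_cdf μ
  have hf' : AEStronglyMeasurable f
      ((volume.restrict (Set.Ioo (0 : ℝ) 1)).map (quantile (cdf μ))) := by
    rw [h]; exact hf.aestronglyMeasurable
  rw [← integral_map (aemeasurable_quantile_cdf μ) hf', h]

theorem integrable_posPart_sub {Ω : Type*} [MeasurableSpace Ω] {P : Measure Ω}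
    [IsFiniteMeasure P] {Z : Ω → ℝ} (hZ : Integrable Z P) (c : ℝ) :
    Integrable (fun ω => max (Z ω - c) 0) P :=
  (hZ.sub (integrable_const c)).pos_part

theorem upperInt_eq_setIntegral (F : ℝ → ℝ) {α : ℝ} (hα1 : α < 1) :
    upperInt F α = ∫ t in Set.Ioo α 1, quantile F t := by
  rw [upperInt, intervalIntegral.integral_of_le hα1.le, integral_Ioc_eq_integral_Ioo]

variable {μ}

/-- The upper bound in the Rockafellar–Uryasev variational formula. -/
theorem upperInt_cdf_le (hμ : Integrable (fun x => x) μ) {α : ℝ} (hα0 : 0 < α) (hα1 : α < 1)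
    (c : ℝ) : upperInt (cdf μ) α ≤ (1 - α) * c + ∫ x, max (x - c) 0 ∂μ := by
  have hsub : Set.Ioo α 1 ⊆ Set.Ioo 0 1 := Set.Ioo_subset_Ioo_left hα0.le
  have hq := integrableOn_comp_quantile_cdf μ hμ
  have hg := integrableOn_comp_quantile_cdf μ (integrable_posPart_sub hμ c)
  rw [upperInt_eq_setIntegral _ hα1, ← integral_comp_quantile_cdf μ (integrable_posPart_sub hμ c)]
  calc ∫ t in Set.Ioo α 1, quantile (cdf μ) t
      ≤ ∫ t in Set.Ioo α 1, (c + max (quantile (cdf μ) t - c) 0) := by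
        refine setIntegral_mono (hq.mono_set hsub)
          ((integrableOn_const (by simp)).add (hg.mono_set hsub)) fun t => ?_
        have := le_max_left (quantile (cdf μ) t - c) 0
        show quantile (cdf μ) t ≤ c + max (quantile (cdf μ) t - c) 0
        linarith
    _ = (1 - α) * c + ∫ t in Set.Ioo α 1, max (quantile (cdf μ) t - c) 0 := by
        have hc : IntegrableOn (fun _ : ℝ => c) (Set.Ioo α 1) := integrableOn_const (by simp)
        rw [integral_add hc (hg.mono_set hsub)]
        simp [hα1.le]
    _ ≤ _ := by
        refine add_le_add_right ?_ _
        exact setIntegral_mono_set hg (Eventually.of_forall fun t => le_max_right _ _)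
          hsub.eventuallyLE

/-- The minimum in the Rockafellar–Uryasev formula is attained at the quantile. -/
theorem upperInt_cdf_eq (hμ : Integrable (fun x => x) μ) {α : ℝ} (hα0 : 0 < α) (hα1 : α < 1) :
    upperInt (cdf μ) α = (1 - α) * quantile (cdf μ) α +
      ∫ x, max (x - quantile (cdf μ) α) 0 ∂μ := by
  set c := quantile (cdf μ) α with hc
  have hsub : Set.Ioo α 1 ⊆ Set.Ioo 0 1 := Set.Ioo_subset_Ioo_left hα0.le
  have hq := integrableOn_comp_quantile_cdf μ hμ
  have hg := integrableOn_comp_quantile_cdf μ (integrable_posPart_sub hμ c)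
  have hmono := monotoneOn_quantile_cdf μ
  rw [upperInt_eq_setIntegral _ hα1, ← integral_comp_quantile_cdf μ (integrable_posPart_sub hμ c)]
  -- By monotonicity the positive part vanishes left of `α` and can be dropped right of it.
  have h1 : ∫ t in Set.Ioo 0 1, max (quantile (cdf μ) t - c) 0 =
      ∫ t in Set.Ioo α 1, max (quantile (cdf μ) t - c) 0 := by
    refine (setIntegral_eq_of_subset_of_forall_sdiff_eq_zero measurableSet_Ioo hsub ?_)
    rintro t ⟨ht, ht'⟩
    have : t ≤ α := by
      by_contra! h
      exact ht' ⟨h, ht.2⟩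
    exact max_eq_right (sub_nonpos.2 (hmono ht ⟨hα0, hα1⟩ this))
  have h2 : ∫ t in Set.Ioo α 1, max (quantile (cdf μ) t - c) 0 =
      ∫ t in Set.Ioo α 1, (quantile (cdf μ) t - c) := by
    refine setIntegral_congr_fun measurableSet_Ioo fun t ht => ?_
    exact max_eq_left (sub_nonneg.2 (hmono ⟨hα0, hα1⟩ (hsub ht) ht.1.le))
  rw [h1, h2, integral_sub (hq.mono_set hsub) (integrableOn_const (by simp))]
  simp [hα1.le]

/-- Markov's inequality, since the tail beyond an `α`-quantile has mass at least `ε` on either side.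
This confines the minimiser `c` to a compact interval. -/
theorem abs_quantile_cdf_le (hμ : Integrable (fun x => x) μ) {ε α : ℝ} (hε : 0 < ε)
    (hα : α ∈ Set.Icc ε (1 - ε)) : |quantile (cdf μ) α| ≤ (∫ x, |x| ∂μ) / ε := by
  have hα0 : 0 < α := hε.trans_le hα.1
  have hα1 : α < 1 := by linarith [hα.2]
  have markov : ∀ m : ℝ, 0 ≤ m → ε ≤ μ.real {x | m ≤ |x|} → m ≤ (∫ x, |x| ∂μ) / ε := by
    intro m hm h
    rw [le_div_iff₀ hε]
    exact (mul_le_mul_of_nonneg_left h hm).trans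
      (mul_meas_ge_le_integral_of_nonneg (Eventually.of_forall fun x => abs_nonneg x) hμ.abs m)
  rcases le_total 0 (quantile (cdf μ) α) with h0 | h0
  · rw [abs_of_nonneg h0]
    -- The Galois connection controls the upper tail only at points strictly below the quantile,
    -- which is therefore approached from below.
    refine le_of_forall_lt fun m hm => ?_
    obtain ⟨m', hm1, hm2⟩ := exists_between hm
    rcases lt_or_ge m' 0 with hneg | hpos
    · exact (hm1.trans hneg).trans_le (div_nonneg (integral_nonneg fun x => abs_nonneg x) hε.le)
    refine hm1.trans_le (markov m' hpos ?_)
    have h := (not_congr (quantile_cdf_le_iff μ hα0 hα1 m')).1 (not_le.2 hm2)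
    rw [not_le, cdf_eq_real] at h
    have h3 : μ.real (Set.Iic m')ᶜ = 1 - μ.real (Set.Iic m') := probReal_compl_eq_one_sub measurableSet_Iic
    have h4 : μ.real (Set.Iic m')ᶜ ≤ μ.real {x | m' ≤ |x|} := by
      refine measureReal_mono fun x hx => ?_
      simp only [Set.mem_compl_iff, Set.mem_Iic, not_le] at hx
      exact hx.le.trans (le_abs_self x)
    linarith [hα.2]
  · rw [abs_of_nonpos h0]
    refine markov _ (neg_nonneg.2 h0) ?_
    have h := (quantile_cdf_le_iff μ hα0 hα1 _).1 le_rfl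
    rw [cdf_eq_real] at h
    refine hα.1.trans (h.trans (measureReal_mono fun x hx => ?_))
    have : x ≤ quantile (cdf μ) α := hx
    exact (neg_le_neg this).trans (neg_le_abs x)

/-- Let `c` be the quantile, `A = E(x₊)`, `G = E(x - c)₊`, and write the integral as `(1 - α)(c + G)
+ αG`. If `c ≥ 0`, then `c + G ≥ A` and the first term suffices. If `c ≤ 0`, then `G ≥ A`, and mean
zero gives `c + G ≥ 0`, so the second term suffices. -/
theorem mul_integral_posPart_le_upperInt_cdf (hμ : Integrable (fun x => x) μ)
    (h0 : ∫ x, x ∂μ = 0) {ε α : ℝ} (hε : 0 < ε) (hα : α ∈ Set.Icc ε (1 - ε)) :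
    ε * ∫ x, max x 0 ∂μ ≤ upperInt (cdf μ) α := by
  have hα0 : 0 < α := hε.trans_le hα.1
  have hα1 : α < 1 := by linarith [hα.2]
  rw [upperInt_cdf_eq hμ hα0 hα1]
  set c := quantile (cdf μ) α
  have hp : Integrable (fun x => max x 0) μ := hμ.pos_part
  have hg := integrable_posPart_sub hμ c
  set A := ∫ x, max x 0 ∂μ
  set G := ∫ x, max (x - c) 0 ∂μ
  have hA : 0 ≤ A := integral_nonneg fun x => le_max_right _ _
  have hG : 0 ≤ G := integral_nonneg fun x => le_max_right _ _
  rcases le_total 0 c with hc | hc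
  · have h1 : A - c ≤ G := by
      have : ∫ x, (max x 0 - c) ∂μ = A - c := by
        rw [integral_sub hp (integrable_const c)]; simp [A]
      rw [← this]
      refine integral_mono (hp.sub (integrable_const c)) hg fun x => ?_
      show max x 0 - c ≤ max (x - c) 0
      rcases le_total x 0 with h | h
      · rw [max_eq_right h]; exact le_trans (by linarith) (le_max_right _ _)
      · rw [max_eq_left h]; exact le_max_left _ _
    nlinarith [hα.2, mul_nonneg hα0.le hG, mul_nonneg (sub_nonneg.2 hα1.le) hc,
      mul_le_mul_of_nonneg_left h1 (sub_nonneg.2 hα1.le),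
      mul_le_mul_of_nonneg_right hα.2 hA]
  · have h1 : A ≤ G := by
      refine integral_mono hp hg fun x => ?_
      exact max_le_max (by linarith) le_rfl
    have h2 : -c ≤ G := by
      have : ∫ x, (x - c) ∂μ = -c := by
        rw [integral_sub hμ (integrable_const c), h0]; simp
      rw [← this]
      exact integral_mono (hμ.sub (integrable_const c)) hg fun x => le_max_left _ _
    nlinarith [mul_le_mul_of_nonneg_left h1 hα0.le,
      mul_le_mul_of_nonneg_left h2 (sub_nonneg.2 hα1.le), mul_le_mul_of_nonneg_right hα.1 hA]

/-- The variational bound for `μ` is tested at the quantile of `ν`, where the formula for `ν` is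
exact. The condition on `M` places that quantile in the range covered by `h`. -/
theorem upperInt_cdf_le_add {ν : Measure ℝ} [IsProbabilityMeasure ν]
    (hμ : Integrable (fun x => x) μ) (hν : Integrable (fun x => x) ν) {ε α M η : ℝ} (hε : 0 < ε)
    (hα : α ∈ Set.Icc ε (1 - ε)) (hM : (∫ x, |x| ∂ν) / ε ≤ M)
    (h : ∀ c, |c| ≤ M → ∫ x, max (x - c) 0 ∂μ ≤ ∫ x, max (x - c) 0 ∂ν + η) :
    upperInt (cdf μ) α ≤ upperInt (cdf ν) α + η := by
  have hα0 : 0 < α := hε.trans_le hα.1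
  have hα1 : α < 1 := by linarith [hα.2]
  have h1 := h _ ((abs_quantile_cdf_le hν hε hα).trans hM)
  have h2 := upperInt_cdf_le hμ hα0 hα1 (quantile (cdf ν) α)
  rw [upperInt_cdf_eq hν hα0 hα1]
  linarith

end Quantile

/-! ### Transfer from laws to random variables. -/

section RandomVariable

variable {Ω : Type*} [MeasurableSpace Ω] {P : Measure Ω} [IsProbabilityMeasure P]
  {W : Ω → ℝ}

theorem upperInt_cdfOf_le_integral_posPart (hW : Integrable W P)
    {ε α : ℝ} (hε : 0 < ε) (hα : α ∈ Set.Icc ε (1 - ε)) :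
    upperInt (cdfOf P W) α ≤ ∫ ω, max (W ω) 0 ∂P := by
  have hm := hW.aemeasurable
  have := Measure.isProbabilityMeasure_map hm
  have hid : Integrable (fun x => x) (P.map W) :=
    (integrable_map_measure (by fun_prop) hm).2 hW
  have h := upperInt_cdf_le hid (hε.trans_le hα.1) (by linarith [hα.2]) 0
  rw [integral_map hm (by fun_prop)] at h
  simp only [sub_zero, mul_zero, zero_add] at h
  exact h

theorem mul_integral_posPart_le_upperInt_cdfOf (hW : Integrable W P) (h0 : ∫ ω, W ω ∂P = 0)
    {ε α : ℝ} (hε : 0 < ε) (hα : α ∈ Set.Icc ε (1 - ε)) :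
    ε * ∫ ω, max (W ω) 0 ∂P ≤ upperInt (cdfOf P W) α := by
  have hm := hW.aemeasurable
  have := Measure.isProbabilityMeasure_map hm
  have hid : Integrable (fun x => x) (P.map W) :=
    (integrable_map_measure (by fun_prop) hm).2 hW
  have h := mul_integral_posPart_le_upperInt_cdf hid
    (by rw [integral_map hm (by fun_prop)]; exact h0) hε hα
  rwa [integral_map hm (by fun_prop)] at h

theorem upperInt_cdfOf_nonneg (hW : Integrable W P) (h0 : ∫ ω, W ω ∂P = 0)
    {ε α : ℝ} (hε : 0 < ε) (hα : α ∈ Set.Icc ε (1 - ε)) :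
    0 ≤ upperInt (cdfOf P W) α :=
  (mul_nonneg hε.le (integral_nonneg fun _ => le_max_right _ _)).trans
    (mul_integral_posPart_le_upperInt_cdfOf hW h0 hε hα)

/-- The two probability spaces differ because a sample is viewed as a random variable on its index
set, to be compared with the population. -/
theorem abs_upperInt_cdfOf_sub_le {Ω' : Type*} [MeasurableSpace Ω'] {P' : Measure Ω'}
    [IsProbabilityMeasure P'] {W' : Ω' → ℝ} (hW : Integrable W P) (hW' : Integrable W' P')
    {ε α M η : ℝ} (hε : 0 < ε) (hα : α ∈ Set.Icc ε (1 - ε))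
    (hM : (∫ ω, |W ω| ∂P) ≤ M * ε) (hM' : (∫ ω, |W' ω| ∂P') ≤ M * ε)
    (h : ∀ c, |c| ≤ M → |∫ ω, max (W ω - c) 0 ∂P - ∫ ω, max (W' ω - c) 0 ∂P'| ≤ η) :
    |upperInt (cdfOf P W) α - upperInt (cdfOf P' W') α| ≤ η := by
  have hm := hW.aemeasurable
  have hm' := hW'.aemeasurable
  have := Measure.isProbabilityMeasure_map hm
  have := Measure.isProbabilityMeasure_map hm'
  have hid : Integrable (fun x => x) (P.map W) :=
    (integrable_map_measure (by fun_prop) hm).2 hW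
  have hid' : Integrable (fun x => x) (P'.map W') :=
    (integrable_map_measure (by fun_prop) hm').2 hW'
  have h1 := upperInt_cdf_le_add (M := M) (η := η) hid hid' hε hα
    (by rw [integral_map hm' (by fun_prop), div_le_iff₀ hε]; exact hM') fun c hc => by
      rw [integral_map hm (by fun_prop), integral_map hm' (by fun_prop)]
      linarith [(abs_le.1 (h c hc)).2]
  have h2 := upperInt_cdf_le_add (M := M) (η := η) hid' hid hε hα
    (by rw [integral_map hm (by fun_prop), div_le_iff₀ hε]; exact hM) fun c hc => by
      rw [integral_map hm (by fun_prop), integral_map hm' (by fun_prop)]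
      linarith [(abs_le.1 (h c hc)).1]
  have e1 : cdfOf P W = cdf (P.map W) := rfl
  have e2 : cdfOf P' W' = cdf (P'.map W') := rfl
  rw [e1, e2, abs_le]
  constructor <;> linarith

end RandomVariable

/-! ### Empirical laws as laws under the uniform measure on indices. -/

section Empirical

/-- The uniform measure on the first `n` indices. -/
noncomputable def indexMeasure (n : ℕ) : Measure ℕ :=
  (n : ENNReal)⁻¹ • ∑ i ∈ Finset.range n, Measure.dirac i

theorem isProbabilityMeasure_indexMeasure {n : ℕ} (hn : n ≠ 0) :
    IsProbabilityMeasure (indexMeasure n) := by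
  constructor
  simp only [indexMeasure, Measure.smul_apply, Measure.finsetSum_apply, measure_univ,
    Finset.sum_const, Finset.card_range, smul_eq_mul, nsmul_eq_mul, mul_one]
  exact ENNReal.inv_mul_cancel (by exact_mod_cast hn) (ENNReal.natCast_ne_top n)

variable {E : Type*} [NormedAddCommGroup E]

theorem integrable_indexMeasure {n : ℕ} (hn : n ≠ 0) (f : ℕ → E) :
    Integrable f (indexMeasure n) := by
  refine Integrable.smul_measure ?_ (ENNReal.inv_ne_top.2 (by exact_mod_cast hn))
  exact integrable_finsetSum_measure.2 fun i _ => integrable_dirac (by simp)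

variable [NormedSpace ℝ E] [CompleteSpace E]

theorem integral_indexMeasure (n : ℕ) (f : ℕ → E) :
    ∫ i, f i ∂(indexMeasure n) = sampleMean n f := by
  rw [indexMeasure, integral_smul_measure,
    integral_finsetSum_measure fun i _ => integrable_dirac (by simp)]
  simp [sampleMean, integral_dirac]

theorem cdfOf_indexMeasure {n : ℕ} (hn : n ≠ 0) (z : ℕ → ℝ) (t : ℝ) :
    cdfOf (indexMeasure n) z t = empiricalCdf n z t := by
  have hz : Measurable z := Measurable.of_discrete
  have := isProbabilityMeasure_indexMeasure hn
  have := Measure.isProbabilityMeasure_map (μ := indexMeasure n) hz.aemeasurable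
  rw [cdfOf, cdf_eq_real, map_measureReal_apply hz measurableSet_Iic, empiricalCdf,
    ← integral_indicator_one (hz measurableSet_Iic), integral_indexMeasure, sampleMean]
  have h : ∀ i, (z ⁻¹' Set.Iic t).indicator (1 : ℕ → ℝ) i = if z i ≤ t then 1 else 0 :=
    fun i => by
      rw [Set.indicator]
      rfl
  simp only [h, smul_eq_mul, Finset.sum_boole, div_eq_inv_mul]

theorem empiricalCdf_add (n : ℕ) (z : ℕ → ℝ) (t m : ℝ) :
    empiricalCdf n z (t + m) = empiricalCdf n (fun i => z i - m) t := by
  simp only [empiricalCdf, sub_le_iff_le_add]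

end Empirical

/-! ### Weak law of large numbers in a Banach space. -/

section LawOfLargeNumbers

variable {Ω₀ : Type*} [MeasurableSpace Ω₀] {P₀ : Measure Ω₀}
  {Ω : Type*} [MeasurableSpace Ω] {P : Measure Ω} [IsProbabilityMeasure P]
  {E : Type*} [MeasurableSpace E] {X : Ω₀ → E} {Xs : ℕ → Ω → E}

/-- The weak law of large numbers for continuous Banach-valued functions of an i.i.d. sample. -/
theorem tendsto_measure_norm_sampleMean_sub [TopologicalSpace E] [BorelSpace E]
    {B : Type*} [NormedAddCommGroup B] [NormedSpace ℝ B] [CompleteSpace B]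
    (hid : ∀ i, IdentDistrib (Xs i) X P P₀) (hind : iIndepFun Xs P)
    {f : E → B} (hf : Continuous f) (hsm : StronglyMeasurable f)
    (hint : Integrable (fun ω => f (X ω)) P₀)
    {η : ℝ} (hη : 0 < η) :
    Tendsto (fun n => P {ω | η ≤ ‖sampleMean n (fun i => f (Xs i ω)) - ∫ ω, f (X ω) ∂P₀‖})
      atTop (𝓝 0) := by
  borelize B
  have hfid : ∀ i, IdentDistrib (fun ω => f (Xs i ω)) (fun ω => f (X ω)) P P₀ := fun i =>
    (hid i).comp hf.measurable
  have hXint : ∀ i, Integrable (fun ω => f (Xs i ω)) P := fun i => by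
    have h1 := (integrable_map_measure hsm.aestronglyMeasurable (hid i).aemeasurable_snd).2 hint
    rw [← (hid i).map_eq] at h1
    exact h1.comp_aemeasurable (hid i).aemeasurable_fst
  have hmean : ∫ ω, f (X ω) ∂P₀ = ∫ ω, f (Xs 0 ω) ∂P := by
    rw [← integral_map (hid 0).aemeasurable_snd hsm.aestronglyMeasurable,
      ← integral_map (hid 0).aemeasurable_fst hsm.aestronglyMeasurable, (hid 0).map_eq]
  have hslln := strong_law_ae (μ := P) (fun i ω => f (Xs i ω)) (hXint 0)
    (fun i j hij => (hind.indepFun hij).comp hf.measurable hf.measurable)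
    (fun i => (hfid i).trans (hfid 0).symm)
  have h := tendstoInMeasure_of_tendsto_ae
    (f := fun (n : ℕ) ω => (n : ℝ)⁻¹ • ∑ i ∈ Finset.range n, f (Xs i ω)) (fun n =>
      (Finset.aestronglyMeasurable_fun_sum _ fun i _ => (hXint i).aestronglyMeasurable).const_smul _)
    hslln
  rw [tendstoInMeasure_iff_norm] at h
  rw [hmean]
  exact h η hη

end LawOfLargeNumbers

/-! ### Uniform convergence of superquantiles over directions and levels. -/

section Uniform

variable {Ω₀ : Type*} [MeasurableSpace Ω₀] {P₀ : Measure Ω₀} [IsProbabilityMeasure P₀]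
  {Ω : Type*} [MeasurableSpace Ω] {P : Measure Ω} [IsProbabilityMeasure P]
  {E : Type*} [NormedAddCommGroup E] [InnerProductSpace ℝ E]

/-- The stop-loss functions `(q, c) ↦ (x'q - c)₊` on a set of parameters, as a continuous function
depending on the data point `x`. -/
noncomputable def stopLoss (K : Set (E × ℝ)) : E → C(K, ℝ) := fun x =>
  ⟨fun k => max (inner ℝ x k.1.1 - k.1.2) 0, by fun_prop⟩

/-- Currying a jointly continuous function is continuous for the compact-open topology, which is
that of the sup norm when `K` is compact. -/
theorem continuous_stopLoss (K : Set (E × ℝ)) : Continuous (stopLoss K) :=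
  (ContinuousMap.curry ⟨fun z : E × K => max (inner ℝ z.1 z.2.1.1 - z.2.1.2) 0,
    by fun_prop⟩).continuous

theorem abs_inner_le_norm_of_mem_sphere (x : E) {q : E} (hq : q ∈ Metric.sphere (0 : E) 1) :
    |inner ℝ x q| ≤ ‖x‖ := by
  have := abs_real_inner_le_norm x q
  rwa [mem_sphere_zero_iff_norm.1 hq, mul_one] at this

/-- The envelope that makes the `C(K, ℝ)`-valued random element Bochner integrable. -/
theorem norm_stopLoss_le {M : ℝ} (hM : 0 ≤ M)
    [CompactSpace (Metric.sphere (0 : E) 1 ×ˢ Set.Icc (-M) M : Set (E × ℝ))] (x : E) :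
    ‖stopLoss (Metric.sphere (0 : E) 1 ×ˢ Set.Icc (-M) M) x‖ ≤ ‖x‖ + M := by
  rw [ContinuousMap.norm_le _ (by positivity)]
  rintro ⟨⟨q, c⟩, hq, hc⟩
  have h1 := abs_le.1 (abs_inner_le_norm_of_mem_sphere x hq)
  have h2 : -M ≤ c := hc.1
  simp only [stopLoss, ContinuousMap.coe_mk, Real.norm_eq_abs]
  rw [abs_of_nonneg (le_max_right _ _)]
  exact max_le (by linarith [h1.2]) (by positivity)

theorem abs_posPart_sub_le (a b : ℝ) : |max a 0 - max b 0| ≤ |a - b| := by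
  simpa using abs_max_sub_max_le_max a 0 b 0

variable [CompleteSpace E]

/-- The centred projection `A₀'q` of an integrable random vector. -/
noncomputable def centeredProj (P₀ : Measure Ω₀) (X : Ω₀ → E) (q : E) (ω : Ω₀) : ℝ :=
  inner ℝ (X ω - ∫ ω', X ω' ∂P₀) q

omit [CompleteSpace E] in
theorem integrable_centeredProj {X : Ω₀ → E} (hX : Integrable X P₀) (q : E) :
    Integrable (centeredProj P₀ X q) P₀ :=
  (hX.sub (integrable_const _)).inner_const q

theorem integral_centeredProj {X : Ω₀ → E} (hX : Integrable X P₀) (q : E) :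
    ∫ ω, centeredProj P₀ X q ω ∂P₀ = 0 := by
  have h0 : Integrable (fun ω => X ω - ∫ ω', X ω' ∂P₀) P₀ := hX.sub (integrable_const _)
  have h : ∫ ω, inner ℝ q (X ω - ∫ ω', X ω' ∂P₀) ∂P₀ = _ := integral_inner (𝕜 := ℝ) h0 q
  have hcomm : ∀ ω, centeredProj P₀ X q ω = inner ℝ q (X ω - ∫ ω', X ω' ∂P₀) :=
    fun ω => real_inner_comm _ _
  rw [integral_congr_ae (Eventually.of_forall hcomm), h, integral_sub hX (integrable_const _),
    integral_const, probReal_univ, one_smul, sub_self, inner_zero_right]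

/-- The centred empirical cdf in direction `q` is the cdf of a centred projection under the uniform
measure on the indices. -/
theorem empiricalCdf_inner_add {n : ℕ} (hn : n ≠ 0) (x : ℕ → E) (q : E) :
    (fun t => empiricalCdf n (fun i => inner ℝ (x i) q) (t + inner ℝ (sampleMean n x) q)) =
      cdfOf (indexMeasure n) (centeredProj (indexMeasure n) x q) := by
  ext t
  rw [cdfOf_indexMeasure hn, empiricalCdf_add]
  congr 1
  ext i
  simp only [centeredProj, integral_indexMeasure, inner_sub_left]

/-- If the empirical mean, mean absolute deviation and stop-loss transforms of a sample are close to
those of the population, then so are the superquantiles of all projections. -/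
theorem abs_upperInt_centeredProj_sub_le {X : Ω₀ → E} (hX : Integrable X P₀) {ε : ℝ} (hε : 0 < ε)
    {n : ℕ} (hn : n ≠ 0) (x : ℕ → E) {M η : ℝ}
    (hM : ∫ ω, ‖X ω - ∫ ω', X ω' ∂P₀‖ ∂P₀ + 2 ≤ M * ε)
    (hmean : ‖sampleMean n x - ∫ ω', X ω' ∂P₀‖ ≤ η / 2)
    (hmean' : ‖sampleMean n x - ∫ ω', X ω' ∂P₀‖ ≤ 1)
    (habs : |sampleMean n (fun i => ‖x i - ∫ ω', X ω' ∂P₀‖) -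
      ∫ ω, ‖X ω - ∫ ω', X ω' ∂P₀‖ ∂P₀| ≤ 1)
    {q : E} (hq : q ∈ Metric.sphere (0 : E) 1)
    (hloss : ∀ c, |c| ≤ M → |sampleMean n (fun i => max (inner ℝ (x i - ∫ ω', X ω' ∂P₀) q - c) 0) -
      ∫ ω, max (inner ℝ (X ω - ∫ ω', X ω' ∂P₀) q - c) 0 ∂P₀| ≤ η / 2)
    {α : ℝ} (hα : α ∈ Set.Icc ε (1 - ε)) :
    |upperInt (cdfOf (indexMeasure n) (centeredProj (indexMeasure n) x q)) α -
      upperInt (cdfOf P₀ (centeredProj P₀ X q)) α| ≤ η := by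
  have := isProbabilityMeasure_indexMeasure hn
  have hint : ∀ f : ℕ → ℝ, Integrable f (indexMeasure n) := integrable_indexMeasure hn
  set m := ∫ ω', X ω' ∂P₀ with hm
  have hXm : Integrable (fun ω => X ω - m) P₀ := hX.sub (integrable_const _)
  -- The sample is centred at its own mean but `hloss` uses the population mean; the cost is uniform
  -- in `i` and `q`.
  have hdiff : ∀ i, |centeredProj (indexMeasure n) x q i - inner ℝ (x i - m) q| ≤
      ‖sampleMean n x - m‖ := by
    intro i
    have : centeredProj (indexMeasure n) x q i - inner ℝ (x i - m) q =
        - inner ℝ (sampleMean n x - m) q := by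
      simp only [centeredProj, integral_indexMeasure, inner_sub_left]; ring
    rw [this, abs_neg]
    exact abs_inner_le_norm_of_mem_sphere _ hq
  refine abs_upperInt_cdfOf_sub_le (M := M) (hint _) (integrable_centeredProj hX q) hε hα ?_ ?_ ?_
  -- Of the `2` in `hM`, one unit pays for recentring and one for the sampling error of the mean
  -- deviation.
  · calc ∫ i, |centeredProj (indexMeasure n) x q i| ∂(indexMeasure n)
        ≤ ∫ i, (‖x i - m‖ + 1) ∂(indexMeasure n) := by
          refine integral_mono (hint _) (hint _) fun i => ?_
          have h1 := abs_inner_le_norm_of_mem_sphere (x i - m) hq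
          have h2 := abs_sub_abs_le_abs_sub (centeredProj (indexMeasure n) x q i)
            (inner ℝ (x i - m) q)
          show |centeredProj (indexMeasure n) x q i| ≤ ‖x i - m‖ + 1
          linarith [hdiff i]
      _ = sampleMean n (fun i => ‖x i - m‖) + 1 := by
          rw [integral_add (hint _) (hint _), integral_indexMeasure]; simp
      _ ≤ M * ε := by linarith [(abs_le.1 habs).2]
  · refine le_trans (integral_mono (integrable_centeredProj hX q).abs hXm.norm fun ω => ?_)
      (le_trans (by linarith) hM)
    exact abs_inner_le_norm_of_mem_sphere _ hq
  · intro c hc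
    -- Recentring uses half of `η`, as the positive part is 1-Lipschitz; `hloss` uses the other
    -- half.
    have h1 : |∫ i, max (centeredProj (indexMeasure n) x q i - c) 0 ∂(indexMeasure n) -
        sampleMean n (fun i => max (inner ℝ (x i - m) q - c) 0)| ≤ η / 2 := by
      rw [← integral_indexMeasure, ← integral_sub (hint _) (hint _)]
      refine abs_integral_le_integral_abs.trans ?_
      refine (integral_mono (hint _) (hint fun _ => η / 2) fun i => ?_).trans (by simp)
      refine (abs_posPart_sub_le _ _).trans ?_
      rw [sub_sub_sub_cancel_right]
      exact (hdiff i).trans hmean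
    have h2 := hloss c hc
    have := abs_sub_le (∫ i, max (centeredProj (indexMeasure n) x q i - c) 0 ∂(indexMeasure n))
      (sampleMean n (fun i => max (inner ℝ (x i - m) q - c) 0))
      (∫ ω, max (centeredProj P₀ X q ω - c) 0 ∂P₀)
    simp only [centeredProj] at *
    linarith

variable [FiniteDimensional ℝ E] [MeasurableSpace E] [BorelSpace E]

/-- Uniform weak law of large numbers for the superquantiles of all one-dimensional projections. -/
theorem tendsto_measure_upperInt_centeredProj {X : Ω₀ → E} {Xs : ℕ → Ω → E}
    (hX : Integrable X P₀) (hid : ∀ i, IdentDistrib (Xs i) X P P₀) (hind : iIndepFun Xs P)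
    {ε : ℝ} (hε : 0 < ε) {η : ℝ} (hη : 0 < η) :
    Tendsto (fun n => P {ω | ¬ ∀ q ∈ Metric.sphere (0 : E) 1, ∀ α ∈ Set.Icc ε (1 - ε),
      |upperInt (cdfOf (indexMeasure n)
          (centeredProj (indexMeasure n) (fun i => Xs i ω) q)) α -
        upperInt (cdfOf P₀ (centeredProj P₀ X q)) α| ≤ η}) atTop (𝓝 0) := by
  set m := ∫ ω', X ω' ∂P₀ with hm
  set A := ∫ ω, ‖X ω - m‖ ∂P₀ with hA
  have hA0 : 0 ≤ A := integral_nonneg fun _ => norm_nonneg _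
  set M := (A + 2) / ε with hMdef
  have hM0 : 0 ≤ M := by positivity
  have hMε : A + 2 ≤ M * ε := by rw [hMdef, div_mul_cancel₀ _ hε.ne']
  set K : Set (E × ℝ) := Metric.sphere (0 : E) 1 ×ˢ Set.Icc (-M) M with hK
  have hKc : IsCompact K := (isCompact_sphere 0 1).prod isCompact_Icc
  have : CompactSpace K := isCompact_iff_compactSpace.1 hKc
  have hXm : Integrable (fun ω => X ω - m) P₀ := hX.sub (integrable_const _)
  have hφ : Continuous fun x : E => stopLoss K (x - m) :=
    (continuous_stopLoss K).comp (by fun_prop)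
  have hφint : Integrable (fun ω => stopLoss K (X ω - m)) P₀ := by
    refine Integrable.mono' (hXm.norm.add (integrable_const M))
      (hφ.comp_aestronglyMeasurable hX.aestronglyMeasurable) (Eventually.of_forall fun ω => ?_)
    exact norm_stopLoss_le hM0 _
  -- The norm here is the supremum over `(q, c) ∈ K`, so this one limit carries the uniformity.
  have t1 := tendsto_measure_norm_sampleMean_sub hid hind hφ hφ.stronglyMeasurable hφint
    (half_pos hη)
  have t2 := tendsto_measure_norm_sampleMean_sub hid hind continuous_id
    continuous_id.stronglyMeasurable hX (lt_min (half_pos hη) one_pos)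
  have hψ : Continuous fun x : E => ‖x - m‖ := by fun_prop
  have t3 := tendsto_measure_norm_sampleMean_sub hid hind hψ hψ.stronglyMeasurable
    hXm.norm one_pos
  have t := (t1.add t2).add t3
  rw [add_zero, add_zero] at t
  refine tendsto_of_tendsto_of_tendsto_of_le_of_le' tendsto_const_nhds t
    (Eventually.of_forall fun _ => zero_le) ?_
  filter_upwards [eventually_ne_atTop 0] with n hn
  -- Measurability of this event, which ranges over uncountably many `(q, α)`, is not needed:
  -- monotonicity and subadditivity hold for all sets.
  refine (measure_mono fun ω hω => ?_).trans
    ((measure_union_le _ _).trans (add_le_add_left (measure_union_le _ _) _))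
  by_contra! hbad
  simp only [Set.mem_union, not_or, Set.mem_ofPred_eq, not_le] at hbad
  obtain ⟨⟨b1, b2⟩, b3⟩ := hbad
  refine hω fun q hq α hα => ?_
  have b2' := lt_min_iff.1 b2
  refine abs_upperInt_centeredProj_sub_le hX hε hn _ hMε b2'.1.le b2'.2.le b3.le hq ?_ hα
  intro c hc
  have hk : (q, c) ∈ K := ⟨hq, abs_le.1 hc⟩
  have := (ContinuousMap.norm_coe_le_norm _ (⟨(q, c), hk⟩ : K)).trans b1.le
  -- Evaluation at `(q, c)` commutes with the Bochner integral and returns the scalar stop-loss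
  -- transform.
  rw [ContinuousMap.sub_apply, ContinuousMap.integral_apply hφint] at this
  have e : (sampleMean n fun i => stopLoss K (Xs i ω - m)) ⟨(q, c), hk⟩ =
      sampleMean n fun i => max (inner ℝ (Xs i ω - m) q - c) 0 := by
    simp [sampleMean, stopLoss]
  rw [e] at this
  exact this

end Uniform

/-! ### Denominators bounded away from zero. -/

section NonDegenerate

variable {Ω₀ : Type*} [MeasurableSpace Ω₀] {P₀ : Measure Ω₀} [IsProbabilityMeasure P₀]

-- `|W| = 2W₊ - W` has integral zero.
omit [IsProbabilityMeasure P₀] in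
theorem ae_eq_zero_of_integral_posPart_eq_zero {W : Ω₀ → ℝ} (hW : Integrable W P₀)
    (h0 : ∫ ω, W ω ∂P₀ = 0) (hp : ∫ ω, max (W ω) 0 ∂P₀ = 0) : W =ᵐ[P₀] 0 := by
  have habs : ∫ ω, |W ω| ∂P₀ = 0 := by
    have h : ∀ ω, |W ω| = 2 * max (W ω) 0 - W ω := fun ω => by
      rcases le_total 0 (W ω) with h | h
      · rw [abs_of_nonneg h, max_eq_left h]; ring
      · rw [abs_of_nonpos h, max_eq_right h]; ring
    simp only [h]
    have hi : Integrable (fun ω => 2 * max (W ω) 0) P₀ := hW.pos_part.const_mul 2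
    rw [integral_sub hi hW, integral_const_mul, hp, h0]
    simp
  filter_upwards [(integral_eq_zero_iff_of_nonneg (fun _ => abs_nonneg _) hW.abs).1 habs]
    with ω hω
  exact abs_eq_zero.1 hω

variable {p : ℕ} {X : Ω₀ → EuclideanSpace ℝ (Fin p)}

/-- The `i`-th entry of `V(X)q` is the covariance of `X_i` with `X'q`. -/
theorem varianceMatrix_mulVec_eq_zero (hX2 : MemLp X 2 P₀) {q : EuclideanSpace ℝ (Fin p)}
    (hq : centeredProj P₀ X q =ᵐ[P₀] 0) :
    (varianceMatrix P₀ X).mulVec (fun j => q j) = 0 := by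
  have hX : Integrable X P₀ := hX2.integrable one_le_two
  have hcoord : ∀ j, MemLp (fun ω => X ω j) 2 P₀ := fun j =>
    (EuclideanSpace.proj (𝕜 := ℝ) j).comp_memLp' hX2
  have hmean : ∀ j, (∫ ω, X ω ∂P₀) j = ∫ ω, X ω j ∂P₀ := fun j =>
    ((EuclideanSpace.proj (𝕜 := ℝ) j).integral_comp_comm hX).symm
  have hc : ∀ j, MemLp (fun ω => X ω j - ∫ ω', X ω' j ∂P₀) 2 P₀ := fun j =>
    (hcoord j).sub (memLp_const _)
  ext i
  simp only [Matrix.mulVec, dotProduct, varianceMatrix, Matrix.of_apply, covariance,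
    Pi.zero_apply]
  simp_rw [← integral_mul_const]
  have hij : ∀ j, Integrable (fun ω => (X ω i - ∫ ω', X ω' i ∂P₀) *
      (X ω j - ∫ ω', X ω' j ∂P₀) * q j) P₀ :=
    fun j => ((hc i).integrable_mul (hc j)).mul_const _
  rw [← integral_finsetSum _ fun j _ => hij j]
  refine integral_eq_zero_of_ae ?_
  filter_upwards [hq] with ω hω
  have : centeredProj P₀ X q ω = ∑ j, (X ω j - ∫ ω', X ω' j ∂P₀) * q j := by
    simp [centeredProj, PiLp.inner_apply, hmean, mul_comm]
  rw [this] at hω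
  simp only [mul_assoc, ← Finset.mul_sum]
  rw [hω]
  simp

theorem integral_posPart_centeredProj_pos (hX2 : MemLp X 2 P₀)
    (hV : (varianceMatrix P₀ X).det ≠ 0) {q : EuclideanSpace ℝ (Fin p)} (hq : q ≠ 0) :
    0 < ∫ ω, max (centeredProj P₀ X q ω) 0 ∂P₀ := by
  have hX : Integrable X P₀ := hX2.integrable one_le_two
  refine lt_of_le_of_ne (integral_nonneg fun _ => le_max_right _ _) fun h => ?_
  have hz := varianceMatrix_mulVec_eq_zero hX2 (ae_eq_zero_of_integral_posPart_eq_zero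
    (integrable_centeredProj hX q) (integral_centeredProj hX q) h.symm)
  have := Matrix.eq_zero_of_mulVec_eq_zero hV hz
  exact hq (by ext j; exact congrFun this j)

/-- With a non-singular variance matrix, the superquantiles of the centred projections are bounded
away from zero. -/
theorem exists_pos_le_upperInt_centeredProj (hX2 : MemLp X 2 P₀)
    (hV : (varianceMatrix P₀ X).det ≠ 0) {ε : ℝ} (hε : 0 < ε) :
    ∃ d : ℝ, 0 < d ∧ ∀ q ∈ Metric.sphere (0 : EuclideanSpace ℝ (Fin p)) 1,
      ∀ α ∈ Set.Icc ε (1 - ε), d ≤ upperInt (cdfOf P₀ (centeredProj P₀ X q)) α := by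
  have hX : Integrable X P₀ := hX2.integrable one_le_two
  have hXm : Integrable (fun ω => X ω - ∫ ω', X ω' ∂P₀) P₀ := hX.sub (integrable_const _)
  -- When `p = 0` the sphere is empty and any positive `d` works.
  rcases (Metric.sphere (0 : EuclideanSpace ℝ (Fin p)) 1).eq_empty_or_nonempty with he | hne
  · exact ⟨1, one_pos, by simp [he]⟩
  have hcont : ContinuousOn (fun q => ∫ ω, max (centeredProj P₀ X q ω) 0 ∂P₀)
      (Metric.sphere (0 : EuclideanSpace ℝ (Fin p)) 1) := by
    refine continuousOn_of_dominated (bound := fun ω => ‖X ω - ∫ ω', X ω' ∂P₀‖)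
      (fun q _ => (integrable_centeredProj hX q).pos_part.aestronglyMeasurable)
      (fun q hq => Eventually.of_forall fun ω => ?_) hXm.norm
      (Eventually.of_forall fun ω => ?_)
    · rw [Real.norm_eq_abs, abs_of_nonneg (le_max_right _ _)]
      exact max_le ((le_abs_self _).trans (abs_inner_le_norm_of_mem_sphere _ hq)) (norm_nonneg _)
    · unfold centeredProj
      fun_prop
  -- The lower bound `ε E(X₀'q)₊` does not involve `α`, so compactness is needed in `q` only.
  obtain ⟨q₀, hq₀, hmin⟩ := (isCompact_sphere 0 1).exists_isMinOn hne hcont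
  refine ⟨ε * ∫ ω, max (centeredProj P₀ X q₀ ω) 0 ∂P₀,
    mul_pos hε (integral_posPart_centeredProj_pos hX2 hV (ne_zero_of_mem_unit_sphere ⟨q₀, hq₀⟩)),
    fun q hq α hα => ?_⟩
  exact (mul_le_mul_of_nonneg_left (hmin hq) hε.le).trans
    (mul_integral_posPart_le_upperInt_cdfOf (integrable_centeredProj hX q)
      (integral_centeredProj hX q) hε hα)

end NonDegenerate

/-! ### Stability of star-shaped sets under perturbation of their radial function. -/

section StarSet

variable {p : ℕ} {ε ρ : ℝ}

theorem radial_le_add {F F' G G' : ℝ → ℝ}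
    (h : ∀ α ∈ Set.Icc ε (1 - ε), superquantileRatio α F G ≤ superquantileRatio α F' G' + ρ) :
    radial ε F G ≤ radial ε F' G' + ρ := by
  rw [← EReal.sub_le_iff_le_add (.inl (EReal.coe_ne_bot ρ)) (.inl (EReal.coe_ne_top ρ))]
  refine le_iInf₂ fun α hα => ?_
  rw [EReal.sub_le_iff_le_add (.inl (EReal.coe_ne_bot ρ)) (.inl (EReal.coe_ne_top ρ))]
  exact (iInf₂_le α hα).trans (h α hα)

/-- A point is pulled back along its own ray by `ρ`, stopping at the origin, which `h0` makes
admissible. -/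
theorem exists_mem_starSet_edist_le {F F' : ℝ → ℝ} {G G' : EuclideanSpace ℝ (Fin p) → ℝ → ℝ}
    (hρ : 0 ≤ ρ)
    (h0 : ∀ q ∈ Metric.sphere (0 : EuclideanSpace ℝ (Fin p)) 1, 0 ≤ radial ε F' (G' q))
    (h : ∀ q ∈ Metric.sphere (0 : EuclideanSpace ℝ (Fin p)) 1,
      radial ε F (G q) ≤ radial ε F' (G' q) + ρ) :
    ∀ b ∈ starSet ε F G, ∃ b' ∈ starSet ε F' G', edist b b' ≤ ENNReal.ofReal ρ := by
  rintro _ ⟨q, hq, l, hl0, hl, rfl⟩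
  refine ⟨max (l - ρ) 0 • q, ⟨q, hq, max (l - ρ) 0, le_max_right _ _, ?_, rfl⟩, ?_⟩
  · rcases le_total (l - ρ) 0 with hle | hle
    · rw [max_eq_right hle]
      exact h0 q hq
    · rw [max_eq_left hle, EReal.coe_sub,
        EReal.sub_le_iff_le_add (.inl (EReal.coe_ne_bot ρ)) (.inl (EReal.coe_ne_top ρ))]
      exact hl.trans (h q hq)
  · rw [edist_dist]
    refine ENNReal.ofReal_le_ofReal ?_
    rw [dist_eq_norm, ← sub_smul, norm_smul, mem_sphere_zero_iff_norm.1 hq, mul_one,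
      Real.norm_eq_abs, abs_le]
    constructor
    · linarith [max_le (sub_le_self l hρ) hl0]
    · linarith [le_max_left (l - ρ) 0]

/-- `N'/D' - N/D = (N' - N)/D' - N(D' - D)/(D'D)`, where `D' ≥ d/2` because `η ≤ d/2`. -/
theorem abs_div_sub_div_le {N N' D D' C d η : ℝ} (hd : 0 < d) (hN0 : 0 ≤ N) (hNC : N ≤ C)
    (hD : d ≤ D) (hN : |N' - N| ≤ η) (hD' : |D' - D| ≤ η) (hηd : η ≤ d / 2) :
    |N' / D' - N / D| ≤ η * (2 / d + 2 * C / d ^ 2) := by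
  have hη : 0 ≤ η := (abs_nonneg _).trans hN
  have hDpos : 0 < D := hd.trans_le hD
  have hD'd : d / 2 ≤ D' := by linarith [(abs_le.1 hD').1]
  have hD'pos : 0 < D' := (half_pos hd).trans_le hD'd
  have e : N' / D' - N / D = (N' - N) / D' - N * (D' - D) / (D' * D) := by
    field_simp
    ring
  have h1 : |(N' - N) / D'| ≤ η / (d / 2) := by
    rw [abs_div, abs_of_pos hD'pos]
    gcongr
  have h2 : |N * (D' - D) / (D' * D)| ≤ C * η / (d / 2 * d) := by
    rw [abs_div, abs_mul, abs_of_nonneg hN0, abs_of_pos (mul_pos hD'pos hDpos)]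
    have hC := hN0.trans hNC
    gcongr
  rw [e]
  refine (abs_sub _ _).trans ((add_le_add h1 h2).trans (le_of_eq ?_))
  field_simp

/-- Stability of the star-shaped set under uniform perturbation of the superquantiles. -/
theorem hausdorffEDist_starSet_le {F F' : ℝ → ℝ} {G G' : EuclideanSpace ℝ (Fin p) → ℝ → ℝ}
    {C d η : ℝ} (hd : 0 < d)
    (hF0 : ∀ α ∈ Set.Icc ε (1 - ε), 0 ≤ upperInt F α)
    (hF0' : ∀ α ∈ Set.Icc ε (1 - ε), 0 ≤ upperInt F' α)
    (hFC : ∀ α ∈ Set.Icc ε (1 - ε), upperInt F α ≤ C)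
    (hG : ∀ q ∈ Metric.sphere (0 : EuclideanSpace ℝ (Fin p)) 1, ∀ α ∈ Set.Icc ε (1 - ε),
      d ≤ upperInt (G q) α)
    (hFF' : ∀ α ∈ Set.Icc ε (1 - ε), |upperInt F' α - upperInt F α| ≤ η)
    (hGG' : ∀ q ∈ Metric.sphere (0 : EuclideanSpace ℝ (Fin p)) 1, ∀ α ∈ Set.Icc ε (1 - ε),
      |upperInt (G' q) α - upperInt (G q) α| ≤ η)
    (hηd : η ≤ d / 2) (hρ : 0 ≤ ρ) (hηρ : η * (2 / d + 2 * C / d ^ 2) ≤ ρ) :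
    Metric.hausdorffEDist (starSet ε F' G') (starSet ε F G) ≤ ENNReal.ofReal ρ := by
  -- Since `η ≤ d/2`, the perturbed denominators stay positive and the value `⊤` of the ratio never
  -- occurs.
  have hG' : ∀ q ∈ Metric.sphere (0 : EuclideanSpace ℝ (Fin p)) 1, ∀ α ∈ Set.Icc ε (1 - ε),
      0 < upperInt (G' q) α := fun q hq α hα => by
    linarith [hG q hq α hα, (abs_le.1 (hGG' q hq α hα)).1]
  have hpos : ∀ q ∈ Metric.sphere (0 : EuclideanSpace ℝ (Fin p)) 1, ∀ α ∈ Set.Icc ε (1 - ε),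
      0 < upperInt (G q) α := fun q hq α hα => hd.trans_le (hG q hq α hα)
  have hR : ∀ q ∈ Metric.sphere (0 : EuclideanSpace ℝ (Fin p)) 1, ∀ α ∈ Set.Icc ε (1 - ε),
      superquantileRatio α F (G q) = ((upperInt F α / upperInt (G q) α : ℝ) : EReal) :=
    fun q hq α hα => if_neg (hpos q hq α hα).ne'
  have hR' : ∀ q ∈ Metric.sphere (0 : EuclideanSpace ℝ (Fin p)) 1, ∀ α ∈ Set.Icc ε (1 - ε),
      superquantileRatio α F' (G' q) = ((upperInt F' α / upperInt (G' q) α : ℝ) : EReal) :=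
    fun q hq α hα => if_neg (hG' q hq α hα).ne'
  have hclose : ∀ q ∈ Metric.sphere (0 : EuclideanSpace ℝ (Fin p)) 1, ∀ α ∈ Set.Icc ε (1 - ε),
      |upperInt F' α / upperInt (G' q) α - upperInt F α / upperInt (G q) α| ≤ ρ :=
    fun q hq α hα => (abs_div_sub_div_le hd (hF0 α hα) (hFC α hα) (hG q hq α hα) (hFF' α hα)
      (hGG' q hq α hα) hηd).trans hηρ
  refine Metric.hausdorffEDist_le_of_mem_edist
    (exists_mem_starSet_edist_le hρ (fun q hq => ?_) fun q hq => ?_)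
    (exists_mem_starSet_edist_le hρ (fun q hq => ?_) fun q hq => ?_)
  · refine le_iInf₂ fun α hα => ?_
    rw [hR q hq α hα]
    exact_mod_cast div_nonneg (hF0 α hα) (hpos q hq α hα).le
  · refine radial_le_add fun α hα => ?_
    rw [hR q hq α hα, hR' q hq α hα, ← EReal.coe_add, EReal.coe_le_coe_iff]
    linarith [(abs_le.1 (hclose q hq α hα)).2]
  · refine le_iInf₂ fun α hα => ?_
    rw [hR' q hq α hα]
    exact_mod_cast div_nonneg (hF0' α hα) (hG' q hq α hα).le
  · refine radial_le_add fun α hα => ?_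
    rw [hR q hq α hα, hR' q hq α hα, ← EReal.coe_add, EReal.coe_le_coe_iff]
    linarith [(abs_le.1 (hclose q hq α hα)).1]

end StarSet

/-! ### Identification of the estimator and of the asymptotic regime. -/

section Assembly

variable {Ω₀ : Type*} [MeasurableSpace Ω₀]

/-- Brings `Y` under the results on projections, with space `ℝ` and direction `1`. -/
theorem centeredProj_one (P₀ : Measure Ω₀) (Y : Ω₀ → ℝ) :
    centeredProj P₀ Y (1 : ℝ) = fun ω => Y ω - ∫ ω', Y ω' ∂P₀ := by
  ext ω
  simp [centeredProj]

theorem empiricalCdf_add_sampleMean {n : ℕ} (hn : n ≠ 0) (y : ℕ → ℝ) :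
    (fun t => empiricalCdf n y (t + sampleMean n y)) =
      cdfOf (indexMeasure n) (centeredProj (indexMeasure n) y 1) := by
  rw [← empiricalCdf_inner_add hn]
  simp

theorem pluginSet_eq_starSet {p nY nX : ℕ} (hY : nY ≠ 0) (hX : nX ≠ 0) (ε : ℝ) (y : ℕ → ℝ)
    (x : ℕ → EuclideanSpace ℝ (Fin p)) :
    pluginSet ε nY nX y x =
      starSet ε (cdfOf (indexMeasure nY) (centeredProj (indexMeasure nY) y 1))
        (fun q => cdfOf (indexMeasure nX) (centeredProj (indexMeasure nX) x q)) := by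
  rw [pluginSet, empiricalCdf_add_sampleMean hY]
  congr 1
  ext1 q
  exact empiricalCdf_inner_add hX x q

/-- The effective size is at most each of the two sample sizes, including at `(0, 0)`, where the
quotient is `0`. -/
theorem tendsto_effectiveSize :
    Tendsto Prod.fst (comap effectiveSize atTop) atTop ∧
      Tendsto Prod.snd (comap effectiveSize atTop) atTop := by
  constructor <;> rw [← tendsto_natCast_atTop_iff (R := ℝ)] <;>
    refine tendsto_atTop_mono (fun m => ?_) tendsto_comap <;>
    exact div_le_of_le_mul₀ (by positivity) (by positivity)
      (by nlinarith [mul_self_nonneg (m.1 : ℝ), mul_self_nonneg (m.2 : ℝ)])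

end Assembly

end TwoSample

/-! ### Consistency of the plug-in set. -/

theorem theorem2 {p : ℕ}
    -- the population, on which `Y` and `X` have the moment and linearity properties
    {Ω₀ : Type*} [MeasurableSpace Ω₀] (P₀ : Measure Ω₀) [IsProbabilityMeasure P₀]
    (Y : Ω₀ → ℝ) (X : Ω₀ → EuclideanSpace ℝ (Fin p))
    (hYmeas : Measurable Y) (hXmeas : Measurable X)
    (hY2 : MemLp Y 2 P₀) (hX2 : MemLp X 2 P₀)
    (hVY : 0 < variance Y P₀) (hVX : (TwoSample.varianceMatrix P₀ X).det ≠ 0)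
    (hlin : ∃ (α₀ : ℝ) (β₀ : EuclideanSpace ℝ (Fin p)),
      P₀[Y | MeasurableSpace.comap X inferInstance] =ᵐ[P₀] fun ω => α₀ + inner ℝ (X ω) β₀)
    -- the two independent i.i.d. samples
    {Ω : Type*} [MeasurableSpace Ω] (P : Measure Ω) [IsProbabilityMeasure P]
    (Ys : ℕ → Ω → ℝ) (Xs : ℕ → Ω → EuclideanSpace ℝ (Fin p))
    (hYid : ∀ i, IdentDistrib (Ys i) Y P P₀) (hXid : ∀ i, IdentDistrib (Xs i) X P P₀)
    (hYind : iIndepFun Ys P) (hXind : iIndepFun Xs P)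
    (hYX : IndepFun (fun ω i => Ys i ω) (fun ω i => Xs i ω) P)
    -- the regularization parameter
    (ε : ℝ) (hε0 : 0 < ε) (hε1 : ε < 1 / 2) :
    ∀ δ : ℝ, 0 < δ →
      Tendsto
        (fun m : ℕ × ℕ => P {ω | ENNReal.ofReal δ ≤
          Metric.hausdorffEDist
            (TwoSample.pluginSet ε m.1 m.2 (fun i => Ys i ω) (fun i => Xs i ω))
            (TwoSample.regularizedSet P₀ ε Y X)})
        (comap TwoSample.effectiveSize atTop) (𝓝 0) := by
  have hY : Integrable Y P₀ := hY2.integrable one_le_two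
  have hX : Integrable X P₀ := hX2.integrable one_le_two
  have hone : (1 : ℝ) ∈ Metric.sphere (0 : ℝ) 1 := by simp
  obtain ⟨d, hd, hdle⟩ := TwoSample.exists_pos_le_upperInt_centeredProj hX2 hVX hε0
  set C := ∫ ω, max (TwoSample.centeredProj P₀ Y 1 ω) 0 ∂P₀
  have hC : 0 ≤ C := integral_nonneg fun _ => le_max_right _ _
  intro δ hδ
  have hL : 0 < 2 / d + 2 * C / d ^ 2 := by positivity
  -- The first term keeps the empirical denominators above `d/2`; the second makes the error of the
  -- ratios at most `δ/2`, strictly below `δ` as the non-strict event requires.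
  set η := min (d / 2) (δ / 2 / (2 / d + 2 * C / d ^ 2))
  have hη : 0 < η := lt_min (half_pos hd) (by positivity)
  have hηδ : η * (2 / d + 2 * C / d ^ 2) ≤ δ / 2 :=
    (le_div_iff₀ hL).1 (min_le_right _ _)
  have tY := (TwoSample.tendsto_measure_upperInt_centeredProj hY hYid hYind hε0 hη).comp
    TwoSample.tendsto_effectiveSize.1
  have tX := (TwoSample.tendsto_measure_upperInt_centeredProj hX hXid hXind hε0 hη).comp
    TwoSample.tendsto_effectiveSize.2
  have t := tY.add tX
  rw [add_zero] at t
  refine tendsto_of_tendsto_of_tendsto_of_le_of_le' tendsto_const_nhds t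
    (Eventually.of_forall fun _ => zero_le) ?_
  filter_upwards [TwoSample.tendsto_effectiveSize.1.eventually_ne_atTop 0,
    TwoSample.tendsto_effectiveSize.2.eventually_ne_atTop 0] with m hm1 hm2
  refine (measure_mono fun ω hω => ?_).trans (measure_union_le _ _)
  by_contra hbad
  simp only [Set.mem_union, not_or, Set.mem_ofPred_eq, not_not] at hbad
  have hdist : Metric.hausdorffEDist
      (TwoSample.pluginSet ε m.1 m.2 (fun i => Ys i ω) (fun i => Xs i ω))
      (TwoSample.regularizedSet P₀ ε Y X) ≤ ENNReal.ofReal (δ / 2) := by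
    rw [TwoSample.pluginSet_eq_starSet hm1 hm2, TwoSample.regularizedSet,
      ← TwoSample.centeredProj_one]
    -- The centred empirical law also has mean zero, so its numerator is nonnegative by the
    -- population lemma.
    have := TwoSample.isProbabilityMeasure_indexMeasure hm1
    have hYs := TwoSample.integrable_indexMeasure hm1 fun i => Ys i ω
    exact TwoSample.hausdorffEDist_starSet_le hd
      (fun α hα => TwoSample.upperInt_cdfOf_nonneg (TwoSample.integrable_centeredProj hY 1)
        (TwoSample.integral_centeredProj hY 1) hε0 hα)
      (fun α hα => TwoSample.upperInt_cdfOf_nonneg (TwoSample.integrable_centeredProj hYs 1)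
        (TwoSample.integral_centeredProj hYs 1) hε0 hα)
      (fun α hα => TwoSample.upperInt_cdfOf_le_integral_posPart
        (TwoSample.integrable_centeredProj hY 1) hε0 hα)
      hdle (hbad.1 1 hone) hbad.2 (min_le_left _ _) (by positivity) hηδ
  have hlt : ENNReal.ofReal (δ / 2) < ENNReal.ofReal δ :=
    (ENNReal.ofReal_lt_ofReal_iff hδ).2 (half_lt_self hδ)
  exact absurd (le_trans hω hdist) (not_le.2 hlt)
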